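/- Let $(\Omega,\mathcal F,\mathbb P)$ be a probability space carrying a real random variable $Z$ and a Brownian motion $W=(W_t)_{t\ge 0}$ with continuous paths, with $Z$ and $W$ independent. For a strictly positive random time $\tau$ such that $\tau$, $Z$ and $W$ are independent, the Brownian bridge with length $\tau$ and pinning point $Z$ associated to $W$ is the process $$\zeta_t=W_{t\wedge\tau}-\frac{t\wedge\tau}{\tau}\,W_\tau+\frac{t\wedge\tau}{\tau}\,Z,\qquad t\ge 0 .$$ A process $X$ is Markov with respect to its natural filtration $\mathcal F^X_s=\sigma(X_r,\ r\le s)$ if $\mathbb E[g(X_t)\mid\mathcal F^X_s]=\mathbb E[g(X_t)\mid X_s]$ almost surely for all $0\le s\le t$ and all bounded measurable $g:\mathbb R\to\mathbb R$. **Theorem.** Assume that the law of $Z$ is absolutely continuous with respect to the Lebesgue measure. Then there exist random times $\tau$ for which the Brownian bridge $\zeta$ with length $\tau$ and pinning point $Z$ is not Markov with respect to its natural filtration. More precisely, let $0<T_1<T_2$. 1. After passing, if necessary, to an extension of the probability space (a probability space $(\Omega',\mathcal F',\mathbb P')$ with a measure-preserving map $\pi:\Omega'\to\Omega$, with $Z$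 and $W$ replaced by $Z\circ\pi$ and $W\circ\pi$), there is a random time $\tau>0$ with $\mathbb P'(\tau=T_1)=\mathbb P'(\tau=T_2)=\frac12$ such that $\tau$, $Z$, $W$ are independent and $\zeta$ is not Markov with respect to its natural filtration. 2. For every random time $\tau>0$ on $\Omega$ such that $\tau$, $Z$, $W$ are independent and $\mathbb P(\tau=T_1)=\mathbb P(\tau=T_2)=\frac12$, the process $\zeta$ is not Markov with respect to its natural filtration. Moreover, for all $0<t_1<T_1<t_2<T_2<u$ there is a bounded measurable function $g:\mathbb R\to\mathbb R$ such that it is not the case that $\mathbb E[g(\zeta_u)\mid\zeta_{t_1},\zeta_{t_2}]=\mathbb E[g(\zeta_u)\mid\zeta_{t_2}]$ almost surely. -/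

import Mathlib

open MeasureTheory ProbabilityTheory
open scoped NNReal ENNReal

universe u

namespace RandomBridge

/-- A real Brownian motion on `(Ω, P)` whose coordinates are random variables and all of whose
paths are continuous, so that it is a random element of `C(ℝ₊, ℝ)`. -/
structure IsContinuousBrownian {Ω : Type*} [MeasurableSpace Ω]
    (W : ℝ≥0 → Ω → ℝ) (P : Measure Ω) : Prop where
  isBrownian : IsBrownianReal W P
  measurable : ∀ t, Measurable (W t)
  continuous : ∀ ω, Continuous fun t => W t ω

/-- The Brownian bridge with length `τ` and pinning point `Z` associated to `W`:
`ζ_t = W_{t ∧ τ} - ((t ∧ τ) / τ) W_τ + ((t ∧ τ) / τ) Z`. -/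
noncomputable def bridge {Ω : Type*} (τ : Ω → ℝ≥0) (Z : Ω → ℝ) (W : ℝ≥0 → Ω → ℝ)
    (t : ℝ≥0) (ω : Ω) : ℝ :=
  W (min t (τ ω)) ω - ((min t (τ ω) : ℝ≥0) : ℝ) / (τ ω : ℝ) * W (τ ω) ω
    + ((min t (τ ω) : ℝ≥0) : ℝ) / (τ ω : ℝ) * Z ω

/-- The standing assumptions on the data `(τ, Z, W)` of a Brownian bridge with random length
and random pinning point: `τ` is a strictly positive random time, `Z` is a random variable, `W` is
a Brownian motion, and `τ`, `Z`, `W` are (mutually) independent. -/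
structure IsBridgeData {Ω : Type*} [MeasurableSpace Ω]
    (τ : Ω → ℝ≥0) (Z : Ω → ℝ) (W : ℝ≥0 → Ω → ℝ) (P : Measure Ω) : Prop where
  measurable_length : Measurable τ
  length_pos : ∀ ω, 0 < τ ω
  measurable_pin : Measurable Z
  brownian : IsContinuousBrownian W P
  indep : iIndep ![MeasurableSpace.comap τ inferInstance,
    MeasurableSpace.comap Z inferInstance,
    MeasurableSpace.comap (fun ω t => W t ω) MeasurableSpace.pi] P

theorem IsBridgeData.stronglyMeasurable_bridge {Ω : Type*} [MeasurableSpace Ω]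
    {τ : Ω → ℝ≥0} {Z : Ω → ℝ} {W : ℝ≥0 → Ω → ℝ} {P : Measure Ω}
    (h : IsBridgeData τ Z W P) (t : ℝ≥0) : StronglyMeasurable (bridge τ Z W t) := by
  have hτ := h.measurable_length
  have hZ := h.measurable_pin
  have hW : Measurable (Function.uncurry W) :=
    measurable_uncurry_of_continuous_of_measurable h.brownian.continuous h.brownian.measurable
  have h1 : Measurable fun ω => min t (τ ω) := measurable_const.min hτ
  have h2 : Measurable fun ω => W (min t (τ ω)) ω := hW.comp (h1.prodMk measurable_id)
  have h3 : Measurable fun ω => W (τ ω) ω := hW.comp (hτ.prodMk measurable_id)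
  have h4 : Measurable fun ω => ((min t (τ ω) : ℝ≥0) : ℝ) / (τ ω : ℝ) :=
    h1.coe_nnreal_real.div hτ.coe_nnreal_real
  exact ((h2.sub (h4.mul h3)).add (h4.mul hZ)).stronglyMeasurable

/-- The real process `X` is Markov with respect to its natural filtration
`ℱ_s = σ(X_r, r ≤ s)`: for all `s ≤ t` and all bounded measurable `g`, almost surely,
`E[g(X_t) | ℱ_s] = E[g(X_t) | X_s]`. -/
def IsMarkovNatural {Ω : Type*} [MeasurableSpace Ω] (X : ℝ≥0 → Ω → ℝ)
    (hX : ∀ t, StronglyMeasurable (X t)) (P : Measure Ω) : Prop :=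
  ∀ s t : ℝ≥0, s ≤ t → ∀ g : ℝ → ℝ, Measurable g → (∃ C : ℝ, ∀ x, |g x| ≤ C) →
    P[fun ω => g (X t ω) | Filtration.natural X hX s]
      =ᵐ[P] P[fun ω => g (X t ω) | MeasurableSpace.comap (X s) inferInstance]

end RandomBridge

namespace RandomBridge

/-! ### Conditional independence and regression functions. -/

variable {Ω : Type*} [mΩ : MeasurableSpace Ω] {P : Measure Ω}

/-! Fix `t₁ < T₁ < t₂ < T₂ < u`. The bridge has reached `Z` by time `u`. At time `t₂` it equals `Z`
if `τ = T₁`, and almost surely differs from `Z` if `τ = T₂`, so `(ζ_{t₂}, ζ_u)` reveals `τ`. If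
`ζ_{t₁}` could be dropped from the conditioning, then `ζ_{t₁}` and `ζ_u` would be conditionally
independent given `ζ_{t₂}`, and the law of `ζ_{t₁}` given `ζ_{t₂} = y` would be the same on both
events. But it is Gaussian with variance `t₁ - t₁²/T₁` on one and `t₁ - t₁²/t₂` on the other.

`exists_bounded_regression` gives one regression function `η` valid on both events, and
`regression_ae_eq` computes it on each. The two formulas hold almost everywhere for different laws
of `ζ_{t₂}`: that of `Z`, and one equivalent to Lebesgue measure (`map_add_null_iff`). Absolute
continuity of `Z` makes them hold at a common `y`, where `variance_eq_of_integral_cos_sin_eq` gives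
the contradiction.

For existence, `τ` is read off a fair coin on a product space. -/

theorem setIntegral_mul_condExp {m : MeasurableSpace Ω} (hm : m ≤ mΩ) [SigmaFinite (P.trim hm)]
    {f φ : Ω → ℝ} {s : Set Ω} (hφ : StronglyMeasurable[m] φ) (hf : Integrable f P)
    (hφf : Integrable (φ * f) P) (hs : MeasurableSet[m] s) :
    ∫ ω in s, φ ω * P[f | m] ω ∂P = ∫ ω in s, φ ω * f ω ∂P := by
  rw [← Pi.mul_def (f := φ) (g := f), ← setIntegral_condExp hm hφf hs]
  refine integral_congr_ae (ae_restrict_of_ae ?_)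
  exact (condExp_mul_of_stronglyMeasurable_left hφ hφf hf).symm

/-- If `V` is conditionally independent of `X` given `Y`, then the conditional expectation of
`h X` given `Y` represents `h X` on every event of `σ(Y, V)`. -/
theorem exists_bounded_regression [IsProbabilityMeasure P] {X Y V : Ω → ℝ}
    (hX : Measurable X) (hY : Measurable Y) (hV : Measurable V)
    (hci : ∀ g : ℝ → ℝ, Measurable g → (∃ C : ℝ, ∀ x, |g x| ≤ C) →
      P[fun ω => g (V ω) | MeasurableSpace.comap (fun ω => (X ω, Y ω)) inferInstance]
        =ᵐ[P] P[fun ω => g (V ω) | MeasurableSpace.comap Y inferInstance])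
    {h : ℝ → ℝ} (hh : Measurable h) {C : ℝ≥0} (hC : ∀ x, |h x| ≤ C) :
    ∃ η : ℝ → ℝ, Measurable η ∧ (∀ y, |η y| ≤ C) ∧
      ∀ D : Set (ℝ × ℝ), MeasurableSet D →
        ∫ ω in {ω | (Y ω, V ω) ∈ D}, h (X ω) ∂P = ∫ ω in {ω | (Y ω, V ω) ∈ D}, η (Y ω) ∂P := by
  have hmY : MeasurableSpace.comap Y inferInstance ≤ mΩ := hY.comap_le
  have hmXY : MeasurableSpace.comap (fun ω => (X ω, Y ω)) inferInstance ≤ mΩ :=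
    (hX.prodMk hY).comap_le
  have hle : MeasurableSpace.comap Y inferInstance
      ≤ MeasurableSpace.comap (fun ω => (X ω, Y ω)) inferInstance := by
    rintro _ ⟨s, hs, rfl⟩
    exact ⟨Prod.snd ⁻¹' s, measurable_snd hs, rfl⟩
  have hbdd : ∀ {f : Ω → ℝ}, Measurable f → (∃ C : ℝ, ∀ᵐ ω ∂P, |f ω| ≤ C) → Integrable f P :=
    fun hf ⟨C, hC⟩ => .of_bound hf.aestronglyMeasurable C hC
  have hhX : Integrable (fun ω => h (X ω)) P :=
    hbdd (hh.comp hX) ⟨C, .of_forall fun _ => hC _⟩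
  set H := P[fun ω => h (X ω) | MeasurableSpace.comap Y inferInstance] with hH
  obtain ⟨η₀, hη₀, hη₀H⟩ : ∃ η₀ : ℝ → ℝ, Measurable η₀ ∧ H = η₀ ∘ Y :=
    (stronglyMeasurable_condExp.measurable).exists_eq_measurable_comp
  have hHC : ∀ᵐ ω ∂P, |H ω| ≤ C := ae_bdd_abs_condExp_of_ae_bdd_abs (.of_forall fun _ => hC _)
  -- The factorization `η₀` is bounded by `C` only almost surely along `Y`; truncation gives the
  -- bound everywhere without changing `η₀ ∘ Y` almost surely.
  set η : ℝ → ℝ := fun y => max (-(C : ℝ)) (min C (η₀ y)) with hη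
  have hηm : Measurable η := measurable_const.max (measurable_const.min hη₀)
  have hηC : ∀ y, |η y| ≤ C := fun y =>
    abs_le.2 ⟨le_max_left _ _, max_le (by simp) (min_le_left _ _)⟩
  have hηH : (fun ω => η (Y ω)) =ᵐ[P] H := by
    filter_upwards [hHC] with ω hω
    rw [hη₀H, Function.comp_apply] at hω ⊢
    obtain ⟨h1, h2⟩ := abs_le.1 hω
    simp [hη, h1, h2]
  have hηY : Integrable (fun ω => η (Y ω)) P :=
    hbdd (hηm.comp hY) ⟨C, .of_forall fun _ => hηC _⟩
  refine ⟨η, hηm, hηC, ?_⟩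
  have hYV : ∀ {D}, MeasurableSet D → MeasurableSet {ω | (Y ω, V ω) ∈ D} :=
    fun hD => hY.prodMk hV hD
  refine MeasurableSpace.induction_on_inter generateFrom_prod.symm isPiSystem_prod ?_ ?_ ?_ ?_
  · simp
  · rintro _ ⟨A, hA, B, hB, rfl⟩
    replace hA : MeasurableSet A := hA
    replace hB : MeasurableSet B := hB
    set g : ℝ → ℝ := B.indicator 1 with hg
    have hgm : Measurable g := measurable_one.indicator hB
    have hgC : ∀ x, |g x| ≤ 1 := fun x => by
      by_cases hx : x ∈ B <;> simp [hg, hx]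
    have hgV : Integrable (fun ω => g (V ω)) P :=
      hbdd (hgm.comp hV) ⟨1, .of_forall fun _ => hgC _⟩
    set K := P[fun ω => g (V ω) | MeasurableSpace.comap Y inferInstance] with hK
    have hKm : StronglyMeasurable[MeasurableSpace.comap Y inferInstance] K :=
      stronglyMeasurable_condExp
    have hKC : ∀ᵐ ω ∂P, |K ω| ≤ 1 :=
      ae_bdd_abs_condExp_of_ae_bdd_abs (.of_forall fun _ => hgC _)
    have hYm : Measurable[MeasurableSpace.comap Y inferInstance] Y := comap_measurable Y
    have hXm : Measurable[MeasurableSpace.comap (fun ω => (X ω, Y ω)) inferInstance] X :=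
      measurable_fst.comp (comap_measurable fun ω => (X ω, Y ω))
    have hAm : MeasurableSet[MeasurableSpace.comap Y inferInstance] (Y ⁻¹' A) := hYm hA
    have key : ∀ f : Ω → ℝ, ∫ ω in {ω | (Y ω, V ω) ∈ A ×ˢ B}, f ω ∂P
        = ∫ ω in Y ⁻¹' A, f ω * g (V ω) ∂P := fun f => by
      have : {ω | (Y ω, V ω) ∈ A ×ˢ B} = Y ⁻¹' A ∩ V ⁻¹' B := rfl
      rw [this, ← setIntegral_indicator (hV hB)]
      refine integral_congr_ae (.of_forall fun ω => ?_)
      by_cases hx : V ω ∈ B <;> simp [hg, hx]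
    have hmul : ∀ {f f' : Ω → ℝ} {c c' : ℝ}, Measurable f → Measurable f' →
        (∀ᵐ ω ∂P, |f ω| ≤ c) → (∀ᵐ ω ∂P, |f' ω| ≤ c') → Integrable (f * f') P := by
      intro f f' c c' hf hf' hc hc'
      refine hbdd (hf.mul hf') ⟨c * c', ?_⟩
      filter_upwards [hc, hc'] with ω h1 h2
      rw [Pi.mul_apply, abs_mul]
      exact mul_le_mul h1 h2 (abs_nonneg _) ((abs_nonneg _).trans h1)
    rw [key, key]
    -- This is the symmetry of conditional independence: project `g (V)` onto `σ(X, Y)`, where `hci`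
    -- turns it into the `σ(Y)`-measurable `K`; project `h (X)` onto `σ(Y)`; then undo the
    -- projection of `g (V)`.
    calc ∫ ω in Y ⁻¹' A, h (X ω) * g (V ω) ∂P
        = ∫ ω in Y ⁻¹' A, h (X ω) * P[fun ω => g (V ω) |
            MeasurableSpace.comap (fun ω => (X ω, Y ω)) inferInstance] ω ∂P :=
          (setIntegral_mul_condExp hmXY (hh.comp hXm).stronglyMeasurable hgV
            (hmul (hh.comp hX) (hgm.comp hV) (.of_forall fun _ => hC _)
              (.of_forall fun _ => hgC _)) (hle _ hAm)).symm
      _ = ∫ ω in Y ⁻¹' A, K ω * h (X ω) ∂P := by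
          refine integral_congr_ae (ae_restrict_of_ae ?_)
          filter_upwards [hci g hgm ⟨1, hgC⟩] with ω hω
          rw [hω, mul_comm]
      _ = ∫ ω in Y ⁻¹' A, K ω * H ω ∂P :=
          (setIntegral_mul_condExp hmY hKm hhX
            (hmul (hKm.measurable.mono hmY le_rfl) (hh.comp hX) hKC (.of_forall fun _ => hC _))
            hAm).symm
      _ = ∫ ω in Y ⁻¹' A, η (Y ω) * K ω ∂P := by
          refine integral_congr_ae (ae_restrict_of_ae ?_)
          filter_upwards [hηH] with ω hω
          rw [← hω, mul_comm]
      _ = ∫ ω in Y ⁻¹' A, η (Y ω) * g (V ω) ∂P :=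
          setIntegral_mul_condExp hmY (hηm.comp hYm).stronglyMeasurable hgV
            (hmul (hηm.comp hY) (hgm.comp hV) (.of_forall fun _ => hηC _)
              (.of_forall fun _ => hgC _)) hAm
  · intro D hD ih
    have htot : ∫ ω, h (X ω) ∂P = ∫ ω, η (Y ω) ∂P := by
      rw [integral_congr_ae hηH, hH, integral_condExp hmY]
    have e : {ω | (Y ω, V ω) ∈ Dᶜ} = {ω | (Y ω, V ω) ∈ D}ᶜ := rfl
    rw [e, setIntegral_compl (hYV hD) hhX, setIntegral_compl (hYV hD) hηY, ih, htot]
  · intro f hd hf ih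
    have e : {ω | (Y ω, V ω) ∈ ⋃ i, f i} = ⋃ i, {ω | (Y ω, V ω) ∈ f i} := by
      ext; simp
    have hd' : Pairwise (Function.onFun Disjoint fun i => {ω | (Y ω, V ω) ∈ f i}) :=
      fun i j hij => (hd hij).preimage fun ω => (Y ω, V ω)
    rw [e, integral_iUnion (fun i => hYV (hf i)) hd' hhX.integrableOn,
      integral_iUnion (fun i => hYV (hf i)) hd' hηY.integrableOn]
    exact tsum_congr ih

/-- If on an event `D` of positive probability `X = ε + c Y'` and `Y = Y'`, where `D`, `ε`, `Y'`
are independent, then a regression function of `h X` on `Y` on the event `D` is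
`y ↦ E[h (ε + c y)]`. -/
theorem regression_ae_eq [IsProbabilityMeasure P] {X Y ε Y' : Ω → ℝ} {D : Set Ω}
    (hD : MeasurableSet D) (hPD : P D ≠ 0) (hε : Measurable ε) (hY' : Measurable Y') {c : ℝ}
    (hXD : ∀ ω ∈ D, X ω = ε ω + c * Y' ω) (hYD : ∀ ω ∈ D, Y ω = Y' ω)
    (hind : IndepFun ε Y' P)
    (hDind : IndepFun (D.indicator (1 : Ω → ℝ)) (fun ω => (ε ω, Y' ω)) P)
    {h η : ℝ → ℝ} (hh : Measurable h) (hη : Measurable η) {C : ℝ} (hC : ∀ x, |h x| ≤ C)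
    (hηC : ∀ x, |η x| ≤ C)
    (heq : ∀ B : Set ℝ, MeasurableSet B →
      ∫ ω in D ∩ Y ⁻¹' B, h (X ω) ∂P = ∫ ω in D ∩ Y ⁻¹' B, η (Y ω) ∂P) :
    ∀ᵐ y ∂(P.map Y'), η y = ∫ e, h (e + c * y) ∂(P.map ε) := by
  have := Measure.isProbabilityMeasure_map (μ := P) hε.aemeasurable
  have := Measure.isProbabilityMeasure_map (μ := P) hY'.aemeasurable
  have hmeas2 : Measurable fun p : ℝ × ℝ => h (p.1 + c * p.2) := by fun_prop
  have hint2 : Integrable (fun p : ℝ × ℝ => h (p.1 + c * p.2)) ((P.map ε).prod (P.map Y')) :=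
    .of_bound hmeas2.aestronglyMeasurable C (.of_forall fun _ => hC _)
  have hm : Measurable fun y => ∫ e, h (e + c * y) ∂(P.map ε) :=
    (StronglyMeasurable.integral_prod_left (f := fun e y => h (e + c * y))
      (hmeas2.stronglyMeasurable)).measurable
  refine Integrable.ae_eq_of_forall_setIntegral_eq _ _
    (.of_bound hη.aestronglyMeasurable C (.of_forall fun _ => hηC _))
    hint2.integral_prod_right ?_
  intro B hB _
  -- Restricting to `D` only contributes the factor `P D`, which is later cancelled.
  have hfac : ∀ {ψ : ℝ × ℝ → ℝ}, Measurable ψ →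
      ∫ ω in D, ψ (ε ω, Y' ω) ∂P = P.real D * ∫ ω, ψ (ε ω, Y' ω) ∂P := by
    intro ψ hψ
    have hi : IndepFun (D.indicator (1 : Ω → ℝ)) (fun ω => ψ (ε ω, Y' ω)) P :=
      hDind.comp measurable_id hψ
    have := hi.integral_fun_mul_eq_mul_integral
      (measurable_one.indicator hD).aestronglyMeasurable
      (hψ.comp (hε.prodMk hY')).aestronglyMeasurable
    rw [integral_indicator_one hD] at this
    rw [← this, ← integral_indicator hD]
    refine integral_congr_ae (.of_forall fun ω => ?_)
    by_cases hω : ω ∈ D <;> simp [hω]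
  have hset : ∀ {F G : Ω → ℝ}, (∀ ω ∈ D, F ω = G ω) →
      ∫ ω in D ∩ Y ⁻¹' B, F ω ∂P = ∫ ω in D, (Y' ⁻¹' B).indicator G ω ∂P := by
    intro F G hFG
    have : D ∩ Y ⁻¹' B = D ∩ Y' ⁻¹' B := by
      ext ω
      simp only [Set.mem_inter_iff, Set.mem_preimage]
      exact and_congr_right fun hω => by rw [hYD ω hω]
    rw [this, setIntegral_indicator (hY' hB)]
    exact setIntegral_congr_fun (hD.inter (hY' hB)) fun ω hω => hFG ω hω.1
  have h1 := heq B hB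
  rw [hset (fun ω hω => by rw [hXD ω hω]), hset (fun ω hω => by rw [hYD ω hω])] at h1
  have e1 := hfac (ψ := fun p => (Prod.snd ⁻¹' B).indicator (fun p => h (p.1 + c * p.2)) p)
    (hmeas2.indicator (measurable_snd hB))
  have e2 := hfac (ψ := fun p => (Prod.snd ⁻¹' B).indicator (fun p => η p.2) p)
    ((hη.comp measurable_snd).indicator (measurable_snd hB))
  have hPD' : P.real D ≠ 0 := by simpa [measureReal_def, ENNReal.toReal_eq_zero_iff] using hPD
  have h2 : ∫ ω, (Prod.snd ⁻¹' B).indicator (fun p => η p.2) (ε ω, Y' ω) ∂P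
      = ∫ ω, (Prod.snd ⁻¹' B).indicator (fun p : ℝ × ℝ => h (p.1 + c * p.2)) (ε ω, Y' ω) ∂P :=
    mul_left_cancel₀ hPD' (e2.symm.trans (h1.symm.trans e1))
  have e3 : ∫ y in B, η y ∂(P.map Y')
      = ∫ ω, (Prod.snd ⁻¹' B).indicator (fun p : ℝ × ℝ => η p.2) (ε ω, Y' ω) ∂P := by
    rw [← integral_indicator hB, integral_map hY'.aemeasurable
      (hη.indicator hB).aestronglyMeasurable]
    rfl
  rw [e3, h2, ← integral_map (hε.prodMk hY').aemeasurable
    (hmeas2.indicator (measurable_snd hB)).aestronglyMeasurable,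
    hind.map_prod_eq_prod_map_map hε.aemeasurable hY'.aemeasurable,
    integral_prod_symm _ (hint2.indicator (measurable_snd hB)), ← integral_indicator hB]
  refine integral_congr_ae (.of_forall fun y => ?_)
  by_cases hy : y ∈ B <;> simp [hy, Set.indicator]

/-! ### Gaussian computations. -/

/-- The law of `G + R` is equivalent to Lebesgue measure if `G` has a law equivalent to Lebesgue
measure and `R` is independent of `G`. -/
theorem map_add_null_iff [IsProbabilityMeasure P] {G R : Ω → ℝ} (hG : Measurable G)
    (hR : Measurable R) (hind : IndepFun G R P) (h1 : P.map G ≪ volume) (h2 : volume ≪ P.map G)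
    {s : Set ℝ} (hs : MeasurableSet s) : P {ω | G ω + R ω ∈ s} = 0 ↔ volume s = 0 := by
  have := Measure.isProbabilityMeasure_map (μ := P) hG.aemeasurable
  have := Measure.isProbabilityMeasure_map (μ := P) hR.aemeasurable
  have hm : MeasurableSet {p : ℝ × ℝ | p.1 + p.2 ∈ s} := measurable_add hs
  have e : P {ω | G ω + R ω ∈ s} = ∫⁻ r, P.map G {x | x + r ∈ s} ∂(P.map R) := by
    have : {ω | G ω + R ω ∈ s} = (fun ω => (G ω, R ω)) ⁻¹' {p : ℝ × ℝ | p.1 + p.2 ∈ s} := rfl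
    rw [this, ← Measure.map_apply (hG.prodMk hR) hm,
      hind.map_prod_eq_prod_map_map hG.aemeasurable hR.aemeasurable,
      Measure.prod_apply_symm hm]
    rfl
  -- Translation invariance of Lebesgue measure: whether a section is null does not depend on `r`.
  have key : ∀ r : ℝ, P.map G {x | x + r ∈ s} = 0 ↔ volume s = 0 := fun r => by
    rw [← measure_preimage_add_right volume r s]
    exact ⟨fun h => h2 h, fun h => h1 h⟩
  have hmr : Measurable fun r => P.map G {x | x + r ∈ s} := measurable_measure_prodMk_right hm
  rw [e, lintegral_eq_zero_iff hmr]
  constructor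
  · intro h
    obtain ⟨r, hr⟩ := h.exists
    exact (key r).1 hr
  · intro h
    exact .of_forall fun r => (key r).2 h

/-- Two linear combinations of the values of a Brownian motion at two times are jointly
Gaussian. -/
theorem hasGaussianLaw_sub_mul_prodMk {W : ℝ≥0 → Ω → ℝ} (hW : IsPreBrownianReal W P)
    (a b a' b' : ℝ≥0) (c c' : ℝ) :
    HasGaussianLaw (fun ω => (W a ω - c * W b ω, W a' ω - c' * W b' ω)) P := by
  let I : Finset ℝ≥0 := {a, b, a', b'}
  let p (t : ℝ≥0) (ht : t ∈ I) : (I → ℝ) →L[ℝ] ℝ := ContinuousLinearMap.proj ⟨t, ht⟩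
  let L : (I → ℝ) →L[ℝ] ℝ × ℝ :=
    (p a (by simp [I]) - c • p b (by simp [I])).prod (p a' (by simp [I]) - c' • p b' (by simp [I]))
  exact (hW.isGaussianProcess.hasGaussianLaw I).map L

theorem covariance_sub_mul {W : ℝ≥0 → Ω → ℝ} (hW : IsPreBrownianReal W P)
    (a b a' b' : ℝ≥0) (c c' : ℝ) :
    cov[fun ω => W a ω - c * W b ω, fun ω => W a' ω - c' * W b' ω; P]
      = min a a' - c' * min a b' - c * (min b a' - c' * min b b') := by
  have := hW.isGaussianProcess.isProbabilityMeasure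
  have hL : ∀ t, MemLp (W t) 2 P :=
    fun t => (hW.isGaussianProcess.hasGaussianLaw_eval t).memLp_two
  have hLc : ∀ t (c : ℝ), MemLp (fun ω => c * W t ω) 2 P := fun t c => (hL t).const_mul c
  have hr : ∀ t, cov[fun ω => W t ω, fun ω => W a' ω - c' * W b' ω; P]
      = min t a' - c' * min t b' := fun t => by
    rw [covariance_fun_sub_right (hL _) (hL _) (hLc _ _), covariance_const_mul_right,
      hW.covariance_fun_eval, hW.covariance_fun_eval]
  rw [covariance_fun_sub_left (hL _) (hLc _ _) (Z := fun ω => W a' ω - c' * W b' ω)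
      ((hL a').sub (hLc b' c')),
    covariance_const_mul_left, hr, hr]

/-- The Brownian bridge of length `b` from `0` to `0`, at time `a ≤ b`, has law
`N(0, a - a² / b)`. -/
theorem map_sub_div_mul {W : ℝ≥0 → Ω → ℝ} (hW : IsPreBrownianReal W P)
    {a b : ℝ≥0} (hb : 0 < b) (hab : a ≤ b) :
    P.map (fun ω => W a ω - a / b * W b ω)
      = gaussianReal 0 (a - a ^ 2 / b : ℝ).toNNReal := by
  have := hW.isGaussianProcess.isProbabilityMeasure
  have h := (hasGaussianLaw_sub_mul_prodMk hW a b a b (a / b) (a / b)).fst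
  have hb' : (b : ℝ) ≠ 0 := by positivity
  rw [h.map_eq_gaussianReal]
  congr 2
  · rw [integral_sub (hW.integrable_eval _) ((hW.integrable_eval _).const_mul _),
      integral_const_mul, hW.integral_eval, hW.integral_eval]
    simp
  · rw [← covariance_self h.aemeasurable, covariance_sub_mul hW]
    simp only [min_self, min_eq_left hab, min_eq_right hab]
    field_simp
    ring

/-- The two variables are jointly Gaussian and their covariance `s - (t/T) s - (s/t)(t - t²/T)`
vanishes. -/
theorem indepFun_sub_div_mul {W : ℝ≥0 → Ω → ℝ} (hW : IsPreBrownianReal W P)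
    {s t T : ℝ≥0} (ht : 0 < t) (hst : s ≤ t) (htT : t ≤ T) :
    IndepFun (fun ω => W s ω - s / t * W t ω) (fun ω => W t ω - t / T * W T ω) P := by
  refine (hasGaussianLaw_sub_mul_prodMk hW s t t T _ _).indepFun_of_covariance_eq_zero ?_
  rw [covariance_sub_mul hW]
  have : (t : ℝ) ≠ 0 := by positivity
  simp only [min_self, min_eq_left hst, min_eq_left htT, min_eq_left (hst.trans htT)]
  field_simp
  ring

theorem IndepFun.prodMk_right_of_prodMk_left {α β γ : Type*} [MeasurableSpace α]
    [MeasurableSpace β] [MeasurableSpace γ] [IsProbabilityMeasure P]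
    {X : Ω → α} {Y : Ω → β} {Z : Ω → γ} (hX : Measurable X) (hY : Measurable Y)
    (hZ : Measurable Z) (hXY : IndepFun X Y P) (h : IndepFun (fun ω => (X ω, Y ω)) Z P) :
    IndepFun X (fun ω => (Y ω, Z ω)) P := by
  have hYZ : IndepFun Y Z P := h.comp measurable_snd measurable_id
  have := Measure.isProbabilityMeasure_map (μ := P) hX.aemeasurable
  have := Measure.isProbabilityMeasure_map (μ := P) hY.aemeasurable
  have := Measure.isProbabilityMeasure_map (μ := P) hZ.aemeasurable
  rw [indepFun_iff_map_prod_eq_prod_map_map hX.aemeasurable (hY.prodMk hZ).aemeasurable,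
    hYZ.map_prod_eq_prod_map_map hY.aemeasurable hZ.aemeasurable, ← Measure.prodAssoc_prod,
    ← hXY.map_prod_eq_prod_map_map hX.aemeasurable hY.aemeasurable,
    ← h.map_prod_eq_prod_map_map (hX.prodMk hY).aemeasurable hZ.aemeasurable,
    Measure.map_map MeasurableEquiv.prodAssoc.measurable ((hX.prodMk hY).prodMk hZ)]
  rfl

/-- These are the real and imaginary parts of the characteristic function of `N(y, v)` at `1`. -/
theorem integral_cos_sin_add_gaussianReal (v : ℝ≥0) (y : ℝ) :
    ∫ e, Real.cos (e + y) ∂(gaussianReal 0 v) = Real.cos y * Real.exp (-v / 2) ∧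
    ∫ e, Real.sin (e + y) ∂(gaussianReal 0 v) = Real.sin y * Real.exp (-v / 2) := by
  have hint : Integrable (fun e : ℝ => Complex.exp (((e + y : ℝ) : ℂ) * Complex.I))
      (gaussianReal 0 v) :=
    .of_bound (by fun_prop) 1 (.of_forall fun e => (Complex.norm_exp_ofReal_mul_I _).le)
  have h : ∫ e, Complex.exp (((e + y : ℝ) : ℂ) * Complex.I) ∂(gaussianReal 0 v)
      = (Real.exp (-v / 2) : ℂ) * Complex.exp (y * Complex.I) := by
    have h1 := charFun_gaussianReal (μ := 0) (v := v) 1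
    rw [charFun_apply_real] at h1
    have e : ∀ e : ℝ, Complex.exp (((e + y : ℝ) : ℂ) * Complex.I)
        = Complex.exp ((1 : ℝ) * e * Complex.I) * Complex.exp (y * Complex.I) := fun e => by
      rw [← Complex.exp_add]; push_cast; ring_nf
    simp_rw [e]
    rw [integral_mul_const, h1]
    push_cast
    ring_nf
  have hre : ∀ x : ℝ, Real.cos x = RCLike.re (Complex.exp ((x : ℂ) * Complex.I)) := fun x => by
    simp [Complex.exp_ofReal_mul_I_re]
  have him : ∀ x : ℝ, Real.sin x = RCLike.im (Complex.exp ((x : ℂ) * Complex.I)) := fun x => by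
    simp [Complex.exp_ofReal_mul_I_im]
  constructor
  · simp_rw [hre]
    rw [integral_re hint, h, mul_comm]
    exact Complex.re_mul_ofReal _ _
  · simp_rw [him]
    rw [integral_im hint, h, mul_comm]
    exact Complex.im_mul_ofReal _ _

/-- Two centered Gaussian laws with different variances are not translates of each other. -/
theorem variance_eq_of_integral_cos_sin_eq {v w : ℝ≥0} {y z : ℝ}
    (hc : ∫ e, Real.cos (e + y) ∂(gaussianReal 0 v) = ∫ e, Real.cos (e + z) ∂(gaussianReal 0 w))
    (hs : ∫ e, Real.sin (e + y) ∂(gaussianReal 0 v) = ∫ e, Real.sin (e + z) ∂(gaussianReal 0 w)) :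
    v = w := by
  rw [(integral_cos_sin_add_gaussianReal _ _).1, (integral_cos_sin_add_gaussianReal _ _).1] at hc
  rw [(integral_cos_sin_add_gaussianReal _ _).2, (integral_cos_sin_add_gaussianReal _ _).2] at hs
  -- Squaring and adding the cosine and sine identities eliminates `y` and `z`: only the squared
  -- modulus of the characteristic function remains.
  have h : Real.exp (-v / 2) ^ 2 = Real.exp (-w / 2) ^ 2 := by
    linear_combination (Real.cos y * Real.exp (-v / 2) + Real.cos z * Real.exp (-w / 2)) * hc
      + (Real.sin y * Real.exp (-v / 2) + Real.sin z * Real.exp (-w / 2)) * hs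
      - Real.exp (-v / 2) ^ 2 * Real.sin_sq_add_cos_sq y
      + Real.exp (-w / 2) ^ 2 * Real.sin_sq_add_cos_sq z
  have h' := (sq_eq_sq₀ (Real.exp_pos _).le (Real.exp_pos _).le).1 h
  have h2 := Real.exp_injective h'
  exact NNReal.eq (by linarith)

/-! ### The bridge before and after its length, and the independence of its data. -/

theorem bridge_of_le {Ω : Type*} {τ : Ω → ℝ≥0} {Z : Ω → ℝ} {W : ℝ≥0 → Ω → ℝ} {t : ℝ≥0} {ω : Ω}
    (h : t ≤ τ ω) :
    bridge τ Z W t ω = W t ω - t / τ ω * W (τ ω) ω + t / τ ω * Z ω := by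
  simp [bridge, min_eq_left h]

theorem IsBridgeData.bridge_of_ge {τ : Ω → ℝ≥0} {Z : Ω → ℝ} {W : ℝ≥0 → Ω → ℝ}
    (h : IsBridgeData τ Z W P) {t : ℝ≥0} {ω : Ω} (ht : τ ω ≤ t) :
    bridge τ Z W t ω = Z ω := by
  have : (τ ω : ℝ) ≠ 0 := by exact_mod_cast (h.length_pos ω).ne'
  simp [bridge, min_eq_right ht, this]

theorem IsBridgeData.indepFun_pin_path {τ : Ω → ℝ≥0} {Z : Ω → ℝ} {W : ℝ≥0 → Ω → ℝ}
    (h : IsBridgeData τ Z W P) : IndepFun (fun ω t => W t ω) Z P :=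
  h.indep.indep (i := 2) (j := 1) (by decide)

theorem IsBridgeData.indepFun_length {τ : Ω → ℝ≥0} {Z : Ω → ℝ} {W : ℝ≥0 → Ω → ℝ}
    (h : IsBridgeData τ Z W P) : IndepFun τ (fun ω => (Z ω, fun t => W t ω)) P := by
  have hW : Measurable fun ω t => W t ω := measurable_pi_lambda _ h.brownian.measurable
  have hle : ∀ i, ![MeasurableSpace.comap τ inferInstance, MeasurableSpace.comap Z inferInstance,
      MeasurableSpace.comap (fun ω t => W t ω) MeasurableSpace.pi] i ≤ mΩ := by
    intro i
    fin_cases i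
    · exact h.measurable_length.comap_le
    · exact h.measurable_pin.comap_le
    · exact hW.comap_le
  have := indep_iSup_of_disjoint hle h.indep (S := {0}) (T := {1, 2}) (by simp)
  refine indep_of_indep_of_le_left (indep_of_indep_of_le_right this ?_) ?_
  · rw [iSup_insert, iSup_singleton]
    exact (MeasurableSpace.comap_prodMk Z fun ω t => W t ω).le
  · rw [iSup_singleton]
    rfl

/-! ### Failure of the Markov property. -/

/-- For a two-point length `τ ∈ {T₁, T₂}` the pinning point is not conditionally independent of
`ζ_{t₁}` given `ζ_{t₂}`, if `t₁ < T₁ < t₂ < T₂`. -/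
theorem exists_condExp_ne [IsProbabilityMeasure P] {τ : Ω → ℝ≥0} {Z : Ω → ℝ}
    {W : ℝ≥0 → Ω → ℝ} (hdata : IsBridgeData τ Z W P) (hZac : P.map Z ≪ volume)
    {T₁ T₂ : ℝ≥0} (hP₁ : P {ω | τ ω = T₁} = 1 / 2) (hP₂ : P {ω | τ ω = T₂} = 1 / 2)
    {t₁ t₂ u : ℝ≥0} (ht₁ : 0 < t₁) (h₁ : t₁ < T₁) (h₂ : T₁ < t₂) (h₃ : t₂ < T₂) (h₄ : T₂ < u) :
    ∃ g : ℝ → ℝ, Measurable g ∧ (∃ C : ℝ, ∀ x, |g x| ≤ C) ∧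
      ¬ (P[fun ω => g (bridge τ Z W u ω) |
            MeasurableSpace.comap (fun ω => (bridge τ Z W t₁ ω, bridge τ Z W t₂ ω)) inferInstance]
          =ᵐ[P]
          P[fun ω => g (bridge τ Z W u ω) |
            MeasurableSpace.comap (bridge τ Z W t₂) inferInstance]) := by
  by_contra! hci
  have hB := hdata.brownian.isBrownian.toIsPreBrownianReal
  have hWm := hdata.brownian.measurable
  have hZ := hdata.measurable_pin
  have ht₂ : 0 < t₂ := (ht₁.trans h₁).trans h₂
  have hX := (hdata.stronglyMeasurable_bridge t₁).measurable
  have hY := (hdata.stronglyMeasurable_bridge t₂).measurable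
  have hV := (hdata.stronglyMeasurable_bridge u).measurable
  set X := bridge τ Z W t₁
  set Y := bridge τ Z W t₂
  set V := bridge τ Z W u
  -- the pieces of the bridge on the two events
  set ε₁ : Ω → ℝ := fun ω => W t₁ ω - t₁ / T₁ * W T₁ ω with hε₁
  set ε₂ : Ω → ℝ := fun ω => W t₁ ω - t₁ / t₂ * W t₂ ω with hε₂
  set G : Ω → ℝ := fun ω => W t₂ ω - t₂ / T₂ * W T₂ ω with hG
  have hε₁m : Measurable ε₁ := (hWm _).sub ((hWm _).const_mul _)
  have hε₂m : Measurable ε₂ := (hWm _).sub ((hWm _).const_mul _)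
  have hGm : Measurable G := (hWm _).sub ((hWm _).const_mul _)
  set Y₂ : Ω → ℝ := fun ω => G ω + t₂ / T₂ * Z ω with hY₂
  have hY₂m : Measurable Y₂ := hGm.add (hZ.const_mul _)
  set D₁ : Set Ω := {ω | τ ω = T₁} with hD₁
  set D₂ : Set Ω := {ω | τ ω = T₂} with hD₂
  have hD₁m : MeasurableSet D₁ := hdata.measurable_length (measurableSet_singleton T₁)
  have hD₂m : MeasurableSet D₂ := hdata.measurable_length (measurableSet_singleton T₂)
  have hXD₁ : ∀ ω ∈ D₁, X ω = ε₁ ω + t₁ / T₁ * Z ω := fun ω hω => by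
    have hω : τ ω = T₁ := hω
    simp only [X, bridge_of_le (hω ▸ h₁.le : t₁ ≤ τ ω), hω, hε₁]
  have hYD₁ : ∀ ω ∈ D₁, Y ω = Z ω := fun ω hω => by
    have hω : τ ω = T₁ := hω
    exact hdata.bridge_of_ge (hω ▸ h₂.le)
  have hVD₁ : ∀ ω ∈ D₁, V ω = Z ω := fun ω hω => by
    have hω : τ ω = T₁ := hω
    exact hdata.bridge_of_ge (hω ▸ (h₂.trans (h₃.trans h₄)).le)
  have hYD₂ : ∀ ω ∈ D₂, Y ω = Y₂ ω := fun ω hω => by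
    have hω : τ ω = T₂ := hω
    simp only [Y, bridge_of_le (hω ▸ h₃.le : t₂ ≤ τ ω), hω, hY₂, hG]
  -- Before `t₂`, the bridge of length `T₂` is the bridge of length `t₂` pinned at its own value
  -- `Y₂` there.
  have hXD₂ : ∀ ω ∈ D₂, X ω = ε₂ ω + t₁ / t₂ * Y₂ ω := fun ω hω => by
    have hω : τ ω = T₂ := hω
    simp only [X, bridge_of_le (hω ▸ ((h₁.trans h₂).trans h₃).le : t₁ ≤ τ ω), hω, hY₂, hG, hε₂]
    have : (t₂ : ℝ) ≠ 0 := by positivity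
    have : (T₂ : ℝ) ≠ 0 := by exact_mod_cast (ht₂.trans h₃).ne'
    field_simp
    ring
  have hVD₂ : ∀ ω ∈ D₂, V ω = Z ω := fun ω hω => by
    have hω : τ ω = T₂ := hω
    exact hdata.bridge_of_ge (hω ▸ h₄.le)
  -- independence
  have hev : ∀ (a b : ℝ≥0) (c : ℝ), Measurable fun w : ℝ≥0 → ℝ => w a - c * w b :=
    fun a b c => by fun_prop
  have hind₁ : IndepFun ε₁ Z P :=
    hdata.indepFun_pin_path.comp (hev t₁ T₁ (t₁ / T₁)) measurable_id
  have hindG : IndepFun G Z P :=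
    hdata.indepFun_pin_path.comp (hev t₂ T₂ (t₂ / T₂)) measurable_id
  -- `ε₂` is independent of `G`, and `(ε₂, G)` of `Z`; hence `ε₂` is independent of `(G, Z)`, of
  -- which `Y₂` is a function.
  have hind₂ : IndepFun ε₂ Y₂ P := by
    have h := IndepFun.prodMk_right_of_prodMk_left hε₂m hGm hZ
      (indepFun_sub_div_mul hB ht₂ (h₁.trans h₂).le h₃.le)
      (hdata.indepFun_pin_path.comp ((hev t₁ t₂ (t₁ / t₂)).prodMk (hev t₂ T₂ (t₂ / T₂)))
        measurable_id)
    exact h.comp (φ := id) (ψ := fun p : ℝ × ℝ => p.1 + t₂ / T₂ * p.2) measurable_id (by fun_prop)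
  have hone : ∀ T : ℝ≥0, {ω | τ ω = T}.indicator (1 : Ω → ℝ)
      = ({T} : Set ℝ≥0).indicator (1 : ℝ≥0 → ℝ) ∘ τ := fun T => by
    rfl
  have honem : ∀ T : ℝ≥0, Measurable (({T} : Set ℝ≥0).indicator (1 : ℝ≥0 → ℝ)) := fun T =>
    measurable_one.indicator (measurableSet_singleton T)
  have hDind₁ : IndepFun (D₁.indicator (1 : Ω → ℝ)) (fun ω => (ε₁ ω, Z ω)) P := by
    rw [hD₁, hone]
    exact hdata.indepFun_length.comp (honem T₁)
      (((hev t₁ T₁ (t₁ / T₁)).comp measurable_snd).prodMk measurable_fst)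
  have hDind₂ : IndepFun (D₂.indicator (1 : Ω → ℝ)) (fun ω => (ε₂ ω, Y₂ ω)) P := by
    rw [hD₂, hone]
    exact hdata.indepFun_length.comp (honem T₂)
      (((hev t₁ t₂ (t₁ / t₂)).comp measurable_snd).prodMk
        (((hev t₂ T₂ (t₂ / T₂)).comp measurable_snd).add (measurable_fst.const_mul (t₂ / T₂ : ℝ))))
  -- absolute continuity
  have hGvar : (t₂ - t₂ ^ 2 / T₂ : ℝ).toNNReal ≠ 0 := by
    have : (0 : ℝ) < T₂ := by exact_mod_cast ht₂.trans h₃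
    have h₃' : (t₂ : ℝ) < T₂ := h₃
    have ht₂' : (0 : ℝ) < t₂ := ht₂
    refine (Real.toNNReal_pos.2 (sub_pos.2 ?_)).ne'
    rw [div_lt_iff₀ this]
    nlinarith
  have hGlaw := map_sub_div_mul hB (ht₂.trans h₃) h₃.le
  have hG1 : P.map G ≪ volume := hGlaw ▸ gaussianReal_absolutelyContinuous 0 hGvar
  have hG2 : volume ≪ P.map G := hGlaw ▸ gaussianReal_absolutelyContinuous' 0 hGvar
  have hnull : ∀ (c : ℝ) {s : Set ℝ}, MeasurableSet s →
      (P {ω | G ω + c * Z ω ∈ s} = 0 ↔ volume s = 0) := fun c s hs =>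
    map_add_null_iff hGm (hZ.const_mul c)
      (hindG.comp measurable_id (measurable_id.const_mul c)) hG1 hG2 hs
  have hZY₂ : P.map Z ≪ P.map Y₂ := by
    refine hZac.trans (Measure.AbsolutelyContinuous.mk fun s hs h => ?_)
    rw [Measure.map_apply hY₂m hs] at h
    exact (hnull _ hs).1 h
  -- the two events are determined by `(Y, V)`
  have hτ : ∀ᵐ ω ∂P, ω ∈ D₁ ∪ D₂ := by
    have hd : Disjoint D₁ D₂ := Set.disjoint_left.2 fun ω h h' =>
      (h₂.trans h₃).ne (Eq.trans (Eq.symm h) h')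
    have : P (D₁ ∪ D₂) = 1 := by
      rw [measure_union hd hD₂m, hP₁, hP₂, ENNReal.add_halves]
    exact (prob_compl_eq_zero_iff (hD₁m.union hD₂m)).2 this
  have hne : ∀ᵐ ω ∂P, Y₂ ω ≠ Z ω := by
    -- `Y₂ - Z = G + (t₂/T₂ - 1) Z` has a law without atoms.
    have h0 := (hnull (t₂ / T₂ - 1) (measurableSet_singleton 0)).2 (by simp)
    have : ∀ᵐ ω ∂P, ¬ G ω + (t₂ / T₂ - 1) * Z ω = 0 := by
      rw [ae_iff]; simpa using h0
    filter_upwards [this] with ω hω h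
    exact hω (by rw [← sub_eq_zero] at h; rw [← h, hY₂]; ring)
  have hE : MeasurableSet {p : ℝ × ℝ | p.1 = p.2} :=
    measurableSet_eq_fun measurable_fst measurable_snd
  have hset₁ : ∀ B : Set ℝ, (D₁ ∩ Y ⁻¹' B : Set Ω)
      =ᵐ[P] {ω | (Y ω, V ω) ∈ {p : ℝ × ℝ | p.1 = p.2} ∩ Prod.fst ⁻¹' B} := fun B => by
    refine Filter.eventuallyEq_set.2 ?_
    filter_upwards [hτ, hne] with ω hω hω'
    rcases hω with hω | hω
    · simp [hω, hYD₁ ω hω, hVD₁ ω hω]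
    · have : ω ∉ D₁ := fun h => (h₂.trans h₃).ne (Eq.trans (Eq.symm h) hω)
      simp [this, hYD₂ ω hω, hVD₂ ω hω, hω']
  have hset₂ : ∀ B : Set ℝ, (D₂ ∩ Y ⁻¹' B : Set Ω)
      =ᵐ[P] {ω | (Y ω, V ω) ∈ {p : ℝ × ℝ | p.1 = p.2}ᶜ ∩ Prod.fst ⁻¹' B} := fun B => by
    refine Filter.eventuallyEq_set.2 ?_
    filter_upwards [hτ, hne] with ω hω hω'
    rcases hω with hω | hω
    · have : ω ∉ D₂ := fun h => (h₂.trans h₃).ne (Eq.trans (Eq.symm hω) h)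
      simp [this, hYD₁ ω hω, hVD₁ ω hω]
    · simp [hω, hYD₂ ω hω, hVD₂ ω hω, hω']
  -- comparison of the two regression functions
  have hcmp : ∀ h : ℝ → ℝ, Measurable h → (∀ x, |h x| ≤ 1) →
      ∀ᵐ y ∂(P.map Z), ∫ e, h (e + t₁ / T₁ * y) ∂(P.map ε₁)
        = ∫ e, h (e + t₁ / t₂ * y) ∂(P.map ε₂) := by
    intro h hh hh1
    obtain ⟨η, hη, hηC, hreg⟩ := exists_bounded_regression hX hY hV hci hh (C := 1) hh1
    have a₁ := regression_ae_eq hD₁m (by simp [hP₁]) hε₁m hZ hXD₁ hYD₁ hind₁ hDind₁ hh hη hh1 hηC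
      fun B hB => by
        rw [setIntegral_congr_set (hset₁ B), setIntegral_congr_set (hset₁ B)]
        exact hreg _ (hE.inter (measurable_fst hB))
    have a₂ := regression_ae_eq hD₂m (by simp [hP₂]) hε₂m hY₂m hXD₂ hYD₂ hind₂ hDind₂ hh hη hh1
      hηC fun B hB => by
        rw [setIntegral_congr_set (hset₂ B), setIntegral_congr_set (hset₂ B)]
        exact hreg _ (hE.compl.inter (measurable_fst hB))
    -- `a₂` holds for almost every `y` under the law of `Y₂`; `hZY₂` transfers it to the law of `Z`.
    filter_upwards [a₁, hZY₂.ae_le a₂] with y e₁ e₂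
    rw [← e₁, ← e₂]
  have := Measure.isProbabilityMeasure_map (μ := P) hZ.aemeasurable
  obtain ⟨y, hc, hs⟩ := ((hcmp Real.cos Real.measurable_cos Real.abs_cos_le_one).and
    (hcmp Real.sin Real.measurable_sin Real.abs_sin_le_one)).exists
  rw [map_sub_div_mul hB (ht₁.trans h₁) h₁.le, map_sub_div_mul hB ht₂ (h₁.trans h₂).le] at hc hs
  have hv := variance_eq_of_integral_cos_sin_eq hc hs
  have ht₁' : (0 : ℝ) < t₁ := ht₁
  have h₁' : (t₁ : ℝ) < T₁ := h₁
  have h₂' : (T₁ : ℝ) < t₂ := h₂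
  have hT₁' : (0 : ℝ) < T₁ := ht₁'.trans h₁'
  -- Both variances are nonnegative, so `Real.toNNReal` loses nothing and equality would contradict
  -- `hlt`.
  have hlt : (t₁ : ℝ) ^ 2 / t₂ < t₁ ^ 2 / T₁ := div_lt_div_of_pos_left (by positivity) hT₁' h₂'
  have hle : (t₁ : ℝ) ^ 2 / T₁ ≤ t₁ := by
    rw [div_le_iff₀ hT₁']; nlinarith
  rw [Real.toNNReal_eq_toNNReal_iff (by linarith) (by linarith)] at hv
  linarith

/-- By the tower property, the Markov identity at `t₂ ≤ u`, conditioned down to `σ(ζ_{t₁}, ζ_{t₂})`,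
becomes the identity refuted by `exists_condExp_ne`. -/
theorem not_isMarkovNatural [IsProbabilityMeasure P] {τ : Ω → ℝ≥0} {Z : Ω → ℝ}
    {W : ℝ≥0 → Ω → ℝ} (hdata : IsBridgeData τ Z W P) (hZac : P.map Z ≪ volume)
    {T₁ T₂ : ℝ≥0} (hT₁ : 0 < T₁) (hT : T₁ < T₂)
    (hP₁ : P {ω | τ ω = T₁} = 1 / 2) (hP₂ : P {ω | τ ω = T₂} = 1 / 2) :
    ¬ IsMarkovNatural (bridge τ Z W) hdata.stronglyMeasurable_bridge P := by
  intro hM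
  obtain ⟨t₁, ht₁, h₁⟩ := exists_between hT₁
  obtain ⟨t₂, h₂, h₃⟩ := exists_between hT
  obtain ⟨u, h₄⟩ := exists_gt T₂
  obtain ⟨g, hg, hgC, hne⟩ := exists_condExp_ne hdata hZac hP₁ hP₂ ht₁ h₁ h₂ h₃ h₄
  have hm := hM t₂ u (h₃.trans h₄).le g hg hgC
  set F := Filtration.natural (bridge τ Z W) hdata.stronglyMeasurable_bridge
  have hF : ∀ t ≤ t₂, Measurable[F t₂] (bridge τ Z W t) := fun t ht =>
    ((Filtration.stronglyAdapted_natural hdata.stronglyMeasurable_bridge t).mono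
      (F.mono ht)).measurable
  have hle₁ : MeasurableSpace.comap (fun ω => (bridge τ Z W t₁ ω, bridge τ Z W t₂ ω)) inferInstance
      ≤ F t₂ := ((hF t₁ (h₁.trans h₂).le).prodMk (hF t₂ le_rfl)).comap_le
  have hle₂ : MeasurableSpace.comap (bridge τ Z W t₂) inferInstance ≤
      MeasurableSpace.comap (fun ω => (bridge τ Z W t₁ ω, bridge τ Z W t₂ ω)) inferInstance :=
    (measurable_snd.comp (comap_measurable
      fun ω => (bridge τ Z W t₁ ω, bridge τ Z W t₂ ω))).comap_le
  refine hne ?_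
  refine (condExp_condExp_of_le hle₁ (F.le t₂)).symm.trans ((condExp_congr_ae hm).trans ?_)
  rw [condExp_of_stronglyMeasurable (hle₁.trans (F.le t₂)) (stronglyMeasurable_condExp.mono hle₂)
    integrable_condExp]

/-! ### Extending the probability space by an independent length. -/

theorem iIndep_fin_three {m₀ m₁ m₂ : MeasurableSpace Ω} [IsProbabilityMeasure P]
    (h : ∀ s t r, MeasurableSet[m₀] s → MeasurableSet[m₁] t → MeasurableSet[m₂] r →
      P (s ∩ (t ∩ r)) = P s * (P t * P r)) : iIndep ![m₀, m₁, m₂] P := by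
  rw [iIndep_iff]
  intro S f hf
  -- Indices outside `S` receive the sure event, reducing every subfamily to the full triple.
  have hf' : ∀ i, MeasurableSet[![m₀, m₁, m₂] i] (if i ∈ S then f i else Set.univ) := fun i => by
    split_ifs with hi
    · exact hf i hi
    · exact .univ
  have e₁ : (⋂ i ∈ S, f i) = ⋂ i : Fin 3, if i ∈ S then f i else Set.univ := by
    ext ω
    simp only [Set.mem_iInter]
    exact forall_congr' fun i => by split_ifs with hi <;> simp [hi]
  have e₂ : ∏ i ∈ S, P (f i) = ∏ i : Fin 3, P (if i ∈ S then f i else Set.univ) := by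
    rw [← Finset.prod_subset (Finset.subset_univ S) fun i _ hi => by simp [hi]]
    exact Finset.prod_congr rfl fun i hi => by simp [hi]
  rw [e₁, e₂, Fin.prod_univ_three, mul_assoc, ← h _ _ _ (hf' 0) (hf' 1) (hf' 2)]
  congr 1
  ext ω
  simp [Fin.forall_fin_succ]

theorem IsContinuousBrownian.comp_measurePreserving {Ω' : Type*} [MeasurableSpace Ω']
    {P' : Measure Ω'} {W : ℝ≥0 → Ω → ℝ} (hW : IsContinuousBrownian W P) {π : Ω' → Ω}
    (hπ : MeasurePreserving π P' P) : IsContinuousBrownian (fun t ω => W t (π ω)) P' where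
  isBrownian :=
    { hasLaw := fun I => (hW.isBrownian.hasLaw I).fun_comp hπ.hasLaw
      cont := .of_forall fun ω => hW.continuous (π ω) }
  measurable t := (hW.measurable t).comp hπ.measurable
  continuous ω := hW.continuous (π ω)

/-- On the product of `Ω` with a second probability space, every positive random length carried
by the second factor is independent of the pinning point and the Brownian motion. -/
theorem isBridgeData_prod [IsProbabilityMeasure P] {Z : Ω → ℝ} {W : ℝ≥0 → Ω → ℝ}
    (hZ : Measurable Z) (hW : IsContinuousBrownian W P)
    (hZW : IndepFun Z (fun ω t => W t ω) P) {α : Type*} [MeasurableSpace α] {Q : Measure α}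
    [IsProbabilityMeasure Q] {T : α → ℝ≥0} (hT : Measurable T) (hpos : ∀ a, 0 < T a) :
    IsBridgeData (fun ω : Ω × α => T ω.2) (fun ω => Z ω.1) (fun t ω => W t ω.1) (P.prod Q) where
  measurable_length := hT.comp measurable_snd
  length_pos ω := hpos ω.2
  measurable_pin := hZ.comp measurable_fst
  brownian := hW.comp_measurePreserving measurePreserving_fst
  indep := by
    refine iIndep_fin_three ?_
    rintro _ _ _ ⟨s, hs, rfl⟩ ⟨t, ht, rfl⟩ ⟨r, hr, rfl⟩
    have e₀ : (fun ω : Ω × α => T ω.2) ⁻¹' s = Set.univ ×ˢ (T ⁻¹' s) := by ext; simp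
    have e₁ : (fun ω : Ω × α => Z ω.1) ⁻¹' t = (Z ⁻¹' t) ×ˢ Set.univ := by ext; simp
    have e₂ : (fun (ω : Ω × α) t => W t ω.1) ⁻¹' r = ((fun ω t => W t ω) ⁻¹' r) ×ˢ Set.univ := by
      ext; simp
    rw [e₀, e₁, e₂, Set.prod_inter_prod, Set.prod_inter_prod, Measure.prod_prod,
      Measure.prod_prod, Measure.prod_prod, Measure.prod_prod]
    simp only [Set.univ_inter, Set.inter_univ, measure_univ, one_mul, mul_one]
    rw [hZW.measure_inter_preimage_eq_mul _ _ ht hr, mul_comm]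

end RandomBridge

theorem mainTheorem1 {Ω : Type u} [MeasurableSpace Ω] (P : Measure Ω) [IsProbabilityMeasure P]
    (Z : Ω → ℝ) (W : ℝ≥0 → Ω → ℝ) (hZ : Measurable Z)
    (hZac : P.map Z ≪ volume)
    (hW : RandomBridge.IsContinuousBrownian W P)
    (hZW : IndepFun Z (fun ω t => W t ω) P)
    (T₁ T₂ : ℝ≥0) (hT₁ : 0 < T₁) (hT : T₁ < T₂) :
    -- existence: on an extension of the given space there is such a random length
    (∃ (Ω' : Type u) (_ : MeasurableSpace Ω') (P' : Measure Ω') (_ : IsProbabilityMeasure P')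
        (π : Ω' → Ω) (τ : Ω' → ℝ≥0),
      MeasurePreserving π P' P ∧
      P' {ω | τ ω = T₁} = 1 / 2 ∧ P' {ω | τ ω = T₂} = 1 / 2 ∧
      ∃ h : RandomBridge.IsBridgeData τ (fun ω => Z (π ω)) (fun t ω => W t (π ω)) P',
        ¬ RandomBridge.IsMarkovNatural
          (RandomBridge.bridge τ (fun ω => Z (π ω)) (fun t ω => W t (π ω)))
          h.stronglyMeasurable_bridge P') ∧
    -- every two-point random length on the given space is a witness
    (∀ (τ : Ω → ℝ≥0) (h : RandomBridge.IsBridgeData τ Z W P),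
      P {ω | τ ω = T₁} = 1 / 2 → P {ω | τ ω = T₂} = 1 / 2 →
      ¬ RandomBridge.IsMarkovNatural (RandomBridge.bridge τ Z W) h.stronglyMeasurable_bridge P ∧
      ∀ t₁ t₂ u : ℝ≥0, 0 < t₁ → t₁ < T₁ → T₁ < t₂ → t₂ < T₂ → T₂ < u →
        ∃ g : ℝ → ℝ, Measurable g ∧ (∃ C : ℝ, ∀ x, |g x| ≤ C) ∧
          ¬ (P[fun ω => g (RandomBridge.bridge τ Z W u ω) |
                MeasurableSpace.comap
                  (fun ω => (RandomBridge.bridge τ Z W t₁ ω, RandomBridge.bridge τ Z W t₂ ω))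
                  inferInstance]
              =ᵐ[P]
              P[fun ω => g (RandomBridge.bridge τ Z W u ω) |
                MeasurableSpace.comap (RandomBridge.bridge τ Z W t₂) inferInstance])) := by
  refine ⟨?_, fun τ h hP₁ hP₂ => ⟨RandomBridge.not_isMarkovNatural h hZac hT₁ hT hP₁ hP₂,
    fun t₁ t₂ u ht₁ h₁ h₂ h₃ h₄ => RandomBridge.exists_condExp_ne h hZac hP₁ hP₂ ht₁ h₁ h₂ h₃ h₄⟩⟩
  -- A fair coin chooses between `T₁` and `T₂`; using `Bool` keeps `Ω × Bool` in the universe of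
  -- `Ω`.
  let Q : Measure Bool := (PMF.uniformOfFintype Bool).toMeasure
  let T : Bool → ℝ≥0 := fun b => if b then T₁ else T₂
  have hQ : ∀ b : Bool, Q {b} = 1 / 2 := fun b => by
    simp [Q]
  have hT' : ∀ b, 0 < T b := by
    rintro (_ | _)
    · exact hT₁.trans hT
    · exact hT₁
  have hPr : ∀ (b : Bool) (t : ℝ≥0), T ⁻¹' {t} = {b} →
      P.prod Q {ω : Ω × Bool | T ω.2 = t} = 1 / 2 := fun b t hbt => by
    have : {ω : Ω × Bool | T ω.2 = t} = Set.univ ×ˢ (T ⁻¹' {t}) := by ext; simp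
    rw [this, Measure.prod_prod, measure_univ, one_mul, hbt, hQ]
  have hP₁ := hPr true T₁ (by ext (_ | _) <;> simp [T, hT.ne'])
  have hP₂ := hPr false T₂ (by ext (_ | _) <;> simp [T, hT.ne])
  have hdata := RandomBridge.isBridgeData_prod hZ hW hZW (Q := Q) (T := T)
    (measurable_of_finite T) hT'
  refine ⟨Ω × Bool, inferInstance, P.prod Q, inferInstance, Prod.fst, fun ω => T ω.2,
    measurePreserving_fst, hP₁, hP₂, hdata, ?_⟩
  refine RandomBridge.not_isMarkovNatural hdata ?_ hT₁ hT hP₁ hP₂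
  have : (P.prod Q).map (fun ω => Z ω.1) = P.map Z := by
    have h := Measure.map_map (μ := P.prod Q) hZ measurable_fst
    rw [measurePreserving_fst.map_eq] at h
    exact h.symm
  rwa [this]
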